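/- Let $\mathcal C$ be the set of admissible planet densities: continuous functions $f:\mathbb R^3\to[0,\infty)$ whose support $K_f$ is compact and connected, such that $\partial K_f$ is a finite disjoint union of closed (compact, without boundary), connected 2-dimensional topological submanifolds of $\mathbb R^3$, and the origin lies in the interior of $K_f$. Let $R(f)=\inf\{m : K_f\subset B_m(0)\}$ be the radius of the Brillouin sphere, $M=\int f$ the total mass, and let the spherical harmonic expansion (centred at infinity) of the gravitational potential of $f$ be the series with partial sums $$SHE_N(V_f)(x)=\frac{GM}{R(f)}\sum_{n=0}^N\sum_{m=-n}^n\Big(\frac{R(f)}{r}\Big)^{n+1}C_{n,m}\,\overline Y_{n,m}\Big(\frac{x}{r}\Big),\qquad r=|x|,$$ $$C_{n,m}=\frac1{(2n+1)M}\int_{\mathbb R^3} f(y)\Big(\frac{|y|}{R(f)}\Big)^n\,\overline Y_{n,m}\Big(\frac{y}{|y|}\Big)\,dy,$$ where $G>0$ is the gravitational constant and $\overline Y_{n,m}$ are the fully ($4\pi$-)normalized real spherical harmonics. For $\varepsilon>0$ the expansion *$\varepsilon$-descends* if $SHE_N(V_f)$ converges uniformly, as $N\to\infty$, on the set of points $x$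 with $|x|>R(f)-\varepsilon$ in the free space bounded by the Brillouin sphere and the topography of $K_f$ (that is, $|x|<R(f)$ and $x$ lies in the unbounded component of $\mathbb R^3\setminus K_f$). Then for every $1\le p\le\infty$, every continuous weight function $w:\mathbb R^3\to(0,\infty)$ and every $\varepsilon>0$, the set $\mathcal C_\varepsilon\subset\mathcal C$ of densities whose expansion $\varepsilon$-descends has empty interior in $\mathcal C$ in the topology of the metric $(f_1,f_2)\mapsto\|f_1-f_2\|_{p,w}=\big(\int|f_1-f_2|^p\,w\,dx\big)^{1/p}$ (for $p=\infty$: the sup norm). Equivalently, the complement $\mathcal C\setminus\mathcal C_\varepsilon$ is dense in $\mathcal C$ in this topology. -/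

import Mathlib

open MeasureTheory Filter Topology
open scoped ENNReal

noncomputable section

namespace Planet

/-- Euclidean three-space. -/
abbrev E3 : Type := EuclideanSpace ℝ (Fin 3)

/-! ### Admissible mass densities -/

/-- A closed (compact, without boundary), connected 2-dimensional topological submanifold of
`ℝ³`: with its subspace topology the set is a topological 2-manifold. (It is Hausdorff and
second countable automatically, as a subspace of `ℝ³`.) -/
structure IsClosedSurface (S : Set E3) : Prop where
  isCompact : IsCompact S
  isConnected : IsConnected S
  isManifold : Nonempty (ChartedSpace (EuclideanSpace ℝ (Fin 2)) S)

/-- An admissible planet density: a continuous nonnegative function on `ℝ³` with compact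
connected support, whose boundary is a finite disjoint union of closed surfaces, and such that the
origin is an interior point of the support. -/
structure Density where
  toFun : E3 → ℝ
  continuous' : Continuous toFun
  nonneg' : ∀ x, 0 ≤ toFun x
  hasCompactSupport' : HasCompactSupport toFun
  isConnected_support' : IsConnected (tsupport toFun)
  boundary' : ∃ (k : ℕ) (S : Fin k → Set E3), (∀ i, IsClosedSurface (S i)) ∧
    Pairwise (fun i j => Disjoint (S i) (S j)) ∧ frontier (tsupport toFun) = ⋃ i, S i
  zero_mem_interior' : (0 : E3) ∈ interior (tsupport toFun)

instance : CoeFun Density (fun _ => E3 → ℝ) := ⟨Density.toFun⟩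

/-- The body of the planet, `K_f = supp f` (closed support). -/
def body (f : Density) : Set E3 := tsupport f

/-- The Brillouin radius `R(f) = inf {m | K_f ⊆ B_m(0)}`. -/
def brillouinRadius (f : Density) : ℝ := sInf {m : ℝ | body f ⊆ Metric.ball 0 m}

/-- The total mass of the planet. -/
def totalMass (f : Density) : ℝ := ∫ y, f y

/-- The unbounded part of the complement of `K`: the points off `K` whose connected component in
`ℝ³ \ K` is unbounded. For the body `K` of a planet it is the component that contains the point at
infinity of the complement of the topography (the outermost component of the boundary of `K`);
interior cavities of `K` are not part of it. -/
def outerRegion (K : Set E3) : Set E3 :=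
  {x | x ∈ Kᶜ ∧ ¬ Bornology.IsBounded (connectedComponentIn Kᶜ x)}

/-- The free space bounded by the Brillouin sphere and the topography of the planet. -/
def freeSpace (f : Density) : Set E3 :=
  outerRegion (body f) ∩ Metric.ball 0 (brillouinRadius f)

/-! ### Spherical harmonics -/

/-- The Legendre polynomial `P_n`, by Rodrigues' formula. -/
def legendre (n : ℕ) : Polynomial ℝ :=
  Polynomial.C (1 / (2 ^ n * (n.factorial : ℝ))) *
    Polynomial.derivative^[n] ((Polynomial.X ^ 2 - 1) ^ n)

/-- The normalization constant of the fully (`4π`-)normalized real spherical harmonics,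
`√((2 - δ_{m,0}) (2n+1) (n-m)! / (n+m)!)`, for `0 ≤ m ≤ n`. -/
def normConst (n m : ℕ) : ℝ :=
  Real.sqrt ((if m = 0 then 1 else 2) * (2 * (n : ℝ) + 1) *
    ((n - m).factorial : ℝ) / ((n + m).factorial : ℝ))

/-- The fully normalized real surface spherical harmonic of degree `n` and order `m`, with
`-n ≤ m ≤ n`, at a point `u` of the unit sphere. For
`u = (sin θ cos φ, sin θ sin φ, cos θ)` one has
`sin θ ^ |m| * cos (|m| φ) = Re ((u₀ + i u₁) ^ |m|)`, and likewise for the sine and the imaginary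
part, so that this is `normConst n |m| * P_{n,|m|}(cos θ) * cos (|m| φ)` for `m ≥ 0` and the same
with `sin (|m| φ)` for `m < 0`, where `P_{n,k}(t) = (1 - t²)^(k/2) * P_n^{(k)}(t)` is the associated
Legendre function. -/
def sphHarm (n : ℕ) (m : ℤ) (u : E3) : ℝ :=
  normConst n m.natAbs * (Polynomial.derivative^[m.natAbs] (legendre n)).eval (u 2) *
    (if 0 ≤ m then (((u 0 : ℂ) + (u 1 : ℂ) * Complex.I) ^ m.natAbs).re
      else (((u 0 : ℂ) + (u 1 : ℂ) * Complex.I) ^ m.natAbs).im)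

/-- The direction `x / |x|` of a point. -/
def direction (x : E3) : E3 := ‖x‖⁻¹ • x

/-- The (dimensionless) coefficient `C_{n,m}` of the expansion of the potential
`V_f(x) = G ∫ f(y) / |x - y| dy`:
`C_{n,m} = 1 / ((2n+1) M) * ∫ f(y) (|y| / R)^n Y_{n,m}(y / |y|) dy`. -/
def sheCoeff (f : Density) (n : ℕ) (m : ℤ) : ℝ :=
  1 / ((2 * (n : ℝ) + 1) * totalMass f) *
    ∫ y, f y * (‖y‖ / brillouinRadius f) ^ n * sphHarm n m (direction y)

/-- The truncation at degree `N` of the spherical harmonic expansion, centred at infinity, of the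
gravitational potential of `f`, where `G` is the gravitational constant:
`(G M / R) ∑_{n ≤ N} ∑_{|m| ≤ n} (R / r)^(n+1) C_{n,m} Y_{n,m}(θ, φ)`. -/
def sheTruncation (G : ℝ) (f : Density) (N : ℕ) (x : E3) : ℝ :=
  G * totalMass f / brillouinRadius f *
    ∑ n ∈ Finset.range (N + 1), ∑ m ∈ Finset.Icc (-(n : ℤ)) (n : ℤ),
      (brillouinRadius f / ‖x‖) ^ (n + 1) * sheCoeff f n m * sphHarm n m (direction x)

/-- The spherical harmonic expansion of the potential of `f` `ε`-descends: it converges uniformly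
at the points with `r > R(f) - ε` of the free space bounded by the Brillouin sphere and the
topography. -/
def EpsDescends (G ε : ℝ) (f : Density) : Prop :=
  ∃ g : E3 → ℝ, TendstoUniformlyOn (fun N x => sheTruncation G f N x) g atTop
    {x | x ∈ freeSpace f ∧ brillouinRadius f - ε < ‖x‖}

/-- The set of admissible densities whose spherical harmonic expansion `ε`-descends. -/
def descendSet (G ε : ℝ) : Set Density := {f | EpsDescends G ε f}

/-! ### The weighted `L^p` topologies -/

/-- The `w`-weighted `L^p` norm `(∫ |g|^p w dx)^(1/p)`; for `p = ∞` it is the essential supremum of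
`|g|` for the measure `w dx`, which is the sup norm for continuous `g` and `w > 0`. -/
def weightedNorm (p : ℝ≥0∞) (w : E3 → ℝ) (g : E3 → ℝ) : ℝ≥0∞ :=
  eLpNorm g p (volume.withDensity (fun x => ENNReal.ofReal (w x)))

/-- The metric `(f₁, f₂) ↦ ‖f₁ - f₂‖_{p,w}` on the space of admissible densities. -/
@[reducible]
def weightedMetric (p : ℝ≥0∞) (hp : 1 ≤ p) (w : E3 → ℝ) : PseudoEMetricSpace Density where
  edist f g := weightedNorm p w (fun x => f x - g x)
  edist_self f := by simp [weightedNorm]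
  edist_comm f g := by
    unfold weightedNorm
    rw [← eLpNorm_neg]
    congr 1
    funext x
    simp
  edist_triangle f g h := by
    unfold weightedNorm
    have e : (fun x => f x - h x) = (fun x => f x - g x) + fun x => g x - h x := by
      funext x
      simp
    rw [e]
    exact eLpNorm_add_le (f.continuous'.sub g.continuous').aestronglyMeasurable
      (g.continuous'.sub h.continuous').aestronglyMeasurable hp

/-- The `L^{p,w}`-topology on the space of admissible densities. -/
@[reducible]
def weightedTopology (p : ℝ≥0∞) (hp : 1 ≤ p) (w : E3 → ℝ) : TopologicalSpace Density :=
  (weightedMetric p hp w).toUniformSpace.toTopologicalSpace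

end Planet

end

/-!
The linear functional `f ↦ (n-th term of the expansion of V_f)` at a point `r • northPole` of the
polar axis is, up to the factor `G / r ^ (n + 1)`, the moment of `f` against the zonal solid
harmonic `H_n(y) = |y|^n P_n(y₂ / |y|)`, because all other spherical harmonics vanish at the pole
(`sheTruncation_axis`). `H_n` is a harmonic polynomial (`sum_fderiv_fderiv_zonalSolid`, a recursion
between the coefficients of `P_n`), so by the mean value property
(`integral_radialBump_mul_harmonic`) the moment of a radial bump centred at `-(s • northPole)` is
`H_n(-(s • northPole)) = (-s) ^ n` times the integral of the bump. For `s > r` the expansion of the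
bump therefore diverges at `r • northPole`.

Given `f` with support in the ball of radius `A` about the origin, a small multiple of a function
positive exactly on the ball of radius `A + d` about `-(d • northPole)`, with `d = ε / 2`, is added
to `f`. The new support is that ball, whatever the shape of the support of `f` was. It reaches the
distance `A + 2 * d` in the south, but only `A` in the north, so `(A + d) • northPole` is a point of
the free space at depth less than `ε` below the Brillouin sphere, and there is room in the ball for
a bump at southern distance `A + 3 / 2 * d`. Two such perturbations that differ by this bump cannot
both have a convergent expansion at `(A + d) • northPole` (`not_epsDescends_and`), so one of them
does not descend; both are as close to `f` as desired.
-/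

/-! ### The mean value property of harmonic functions -/

/-- The function `y ↦ (δ² - |y|²)⁺`: a continuous radial bump supported on the ball of radius `δ`.
With this choice `y ↦ radialBump δ y • y` is a constant multiple of the gradient of
`radialBump δ ^ 2`, which is all that the mean value property below needs. -/
noncomputable def radialBump {E : Type*} [NormedAddCommGroup E] (δ : ℝ) (y : E) : ℝ :=
  max 0 (δ ^ 2 - ‖y‖ ^ 2)

section MeanValue

variable {E : Type*} [NormedAddCommGroup E]

lemma continuous_radialBump (δ : ℝ) : Continuous (radialBump δ : E → ℝ) := by
  unfold radialBump
  fun_prop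

lemma radialBump_nonneg (δ : ℝ) (y : E) : 0 ≤ radialBump δ y := le_max_left _ _

lemma radialBump_eq_zero {δ : ℝ} (hδ : 0 ≤ δ) {y : E} (hy : δ ≤ ‖y‖) : radialBump δ y = 0 :=
  max_eq_left (by nlinarith)

lemma radialBump_zero_pos {δ : ℝ} (hδ : 0 < δ) : 0 < radialBump δ (0 : E) :=
  lt_max_of_lt_right (by simp; positivity)

lemma hasCompactSupport_radialBump [ProperSpace E] {δ : ℝ} (hδ : 0 ≤ δ) :
    HasCompactSupport (radialBump δ : E → ℝ) :=
  HasCompactSupport.of_support_subset_isCompact (isCompact_closedBall (0 : E) δ) fun y hy => by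
    by_contra h
    exact hy (radialBump_eq_zero hδ (by simpa using (lt_of_not_ge (by simpa using h)).le))

lemma hasDerivAt_max_zero_sq (s : ℝ) :
    HasDerivAt (fun s : ℝ => max 0 s ^ 2) (2 * max 0 s) s := by
  rcases lt_trichotomy s 0 with h | rfl | h
  · rw [max_eq_left h.le, mul_zero]
    refine (hasDerivAt_const s (0 : ℝ)).congr_of_eventuallyEq ?_
    filter_upwards [Iio_mem_nhds h] with t ht
    exact (congrArg (· ^ 2) (max_eq_left (le_of_lt (Set.mem_Iio.1 ht)))).trans (by simp)
  · have : HasFDerivAt (fun s : ℝ => max 0 s ^ 2) (0 : ℝ →L[ℝ] ℝ) 0 := by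
      refine Asymptotics.IsBigO.hasFDerivAt (n := 2) (Asymptotics.IsBigO.of_bound 1 ?_) one_lt_two
      refine Eventually.of_forall fun t => ?_
      rcases le_total t 0 with ht | ht <;> simp [ht, sq_nonneg]
    simpa using this.hasDerivAt
  · rw [max_eq_right h.le]
    refine HasDerivAt.congr_of_eventuallyEq (f₁ := fun s : ℝ => max 0 s ^ 2) (f := fun s => s ^ 2)
      (by simpa using hasDerivAt_pow 2 s) ?_
    filter_upwards [Ioi_mem_nhds h] with t ht
    exact congrArg (· ^ 2) (max_eq_right (le_of_lt (Set.mem_Ioi.1 ht)))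

variable [InnerProductSpace ℝ E]

lemma hasFDerivAt_radialBump_sq (δ : ℝ) (y : E) :
    HasFDerivAt (fun y : E => radialBump δ y ^ 2)
      ((-4 * radialBump δ y) • (innerSL ℝ y)) y := by
  have h : HasFDerivAt (fun y : E => δ ^ 2 - ‖y‖ ^ 2) (-(2 • innerSL ℝ y)) y :=
    (HasStrictFDerivAt.hasFDerivAt (hasStrictFDerivAt_norm_sq y)).const_sub _
  have := (hasDerivAt_max_zero_sq (δ ^ 2 - ‖y‖ ^ 2)).comp_hasFDerivAt y h
  refine this.congr_fderiv ?_
  ext w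
  simp [radialBump]
  ring

variable [FiniteDimensional ℝ E] [MeasurableSpace E] [BorelSpace E]

/-- Integration by parts against `radialBump δ ^ 2`, whose gradient is `-4 • radialBump δ y • y`. -/
lemma integral_radialBump_mul_inner {δ : ℝ} (hδ : 0 ≤ δ) {v : E → ℝ} (hv : ContDiff ℝ 1 v) (e : E) :
    ∫ y, radialBump δ y * (inner ℝ y e * v y) =
      1 / 4 * ∫ y, radialBump δ y ^ 2 * fderiv ℝ v y e := by
  have hc := continuous_radialBump (E := E) δ
  have hs := hasCompactSupport_radialBump (E := E) hδ
  have hfd : ∀ y : E, fderiv ℝ (fun y : E => radialBump δ y ^ 2) y e * v y =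
      -4 * (radialBump δ y * (inner ℝ y e * v y)) := fun y => by
    rw [(hasFDerivAt_radialBump_sq δ y).fderiv]
    simp
    ring
  have hv' : Continuous fun y => fderiv ℝ v y e :=
    (hv.continuous_fderiv one_ne_zero).clm_apply continuous_const
  have hs2 : ∀ u : E → ℝ, HasCompactSupport fun y => radialBump δ y ^ 2 * u y := fun u =>
    hs.mono fun y hy h0 => hy (by simp [h0])
  have key := integral_mul_fderiv_eq_neg_fderiv_mul_of_integrable (μ := (volume : Measure E))
    (f := fun y : E => radialBump δ y ^ 2) (g := v) (v := e) ?_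
    (((hc.pow 2).mul hv').integrable_of_hasCompactSupport (hs2 _))
    (((hc.pow 2).mul hv.continuous).integrable_of_hasCompactSupport (hs2 _))
    (fun y _ => (hasFDerivAt_radialBump_sq δ y).differentiableAt)
    (fun y _ => hv.differentiable one_ne_zero y)
  · rw [key]
    simp_rw [hfd]
    rw [integral_const_mul]
    ring
  · simp_rw [hfd]
    refine (Continuous.integrable_of_hasCompactSupport ?_ ?_).const_mul _
    · have := hv.continuous
      fun_prop
    · exact hs.mono fun y hy h0 => hy (by simp [h0])

/-- **Mean value property** of harmonic functions, for the weight `radialBump δ`. The average of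
`H` over the bump shrunk by the factor `t` does not depend on `t ∈ [0, 1]`, because its derivative
in `t` is an integral of the Laplacian of `H`. -/
lemma integral_radialBump_mul_harmonic {ι : Type*} [Fintype ι] (b : OrthonormalBasis ι ℝ E)
    {H : E → ℝ} (hH : ContDiff ℝ 2 H)
    (hΔ : ∀ y, ∑ i, fderiv ℝ (fun z => fderiv ℝ H z (b i)) y (b i) = 0)
    {δ : ℝ} (hδ : 0 ≤ δ) (q : E) :
    ∫ y, radialBump δ y * H (q + y) = H q * ∫ y : E, radialBump δ y := by
  have hc := continuous_radialBump (E := E) δ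
  have hs := hasCompactSupport_radialBump (E := E) hδ
  have hH0 := hH.continuous
  have hH1 : Continuous (fderiv ℝ H) := hH.continuous_fderiv two_ne_zero
  have hHd : Differentiable ℝ H := hH.differentiable two_ne_zero
  have hsupp : ∀ u : E → ℝ, HasCompactSupport fun y => radialBump δ y * u y := fun u =>
    hs.mono fun y hy h0 => hy (by simp [h0])
  have hzero : ∀ t : ℝ, ∫ y, radialBump δ y * fderiv ℝ H (q + t • y) y = 0 := by
    intro t
    have hv : ∀ i, ContDiff ℝ 1 fun z => fderiv ℝ H z (b i) := fun i =>
      (hH.fderiv_right (m := 1) (by norm_num)).clm_apply contDiff_const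
    have hvt : ∀ i, ContDiff ℝ 1 fun y => fderiv ℝ H (q + t • y) (b i) := fun i =>
      (hv i).comp (contDiff_const.add (contDiff_const.smul contDiff_id))
    have hexp : ∀ y, radialBump δ y * fderiv ℝ H (q + t • y) y =
        ∑ i, radialBump δ y * (inner ℝ y (b i) * fderiv ℝ H (q + t • y) (b i)) := by
      intro y
      rw [← Finset.mul_sum]
      congr 1
      have := congrArg (fderiv ℝ H (q + t • y)) (b.sum_repr' y)
      rw [map_sum] at this
      rw [← this]
      simp [real_inner_comm]
    have hder : ∀ i y, fderiv ℝ (fun y => fderiv ℝ H (q + t • y) (b i)) y (b i) =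
        t * fderiv ℝ (fun z => fderiv ℝ H z (b i)) (q + t • y) (b i) := by
      intro i y
      have h1 : HasFDerivAt (fun y : E => q + t • y) (t • ContinuousLinearMap.id ℝ E) y :=
        ((hasFDerivAt_id y).const_smul t).const_add q
      have h2 := (((hv i).differentiable one_ne_zero) (q + t • y)).hasFDerivAt.comp y h1
      have h3 := h2.fderiv
      simp only [Function.comp_def] at h3
      rw [h3]
      simp
    simp_rw [hexp]
    rw [integral_finsetSum]
    · simp_rw [integral_radialBump_mul_inner hδ (hvt _), hder]
      rw [← Finset.mul_sum, ← integral_finsetSum]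
      · have : ∀ y, ∑ i, radialBump δ y ^ 2 *
            (t * fderiv ℝ (fun z => fderiv ℝ H z (b i)) (q + t • y) (b i)) = 0 := by
          intro y
          rw [← Finset.mul_sum, ← Finset.mul_sum, hΔ, mul_zero, mul_zero]
        simp [this]
      · intro i _
        refine Continuous.integrable_of_hasCompactSupport ?_
          (hs.mono fun y hy h0 => hy (by simp [h0]))
        have := (((hv i).continuous_fderiv one_ne_zero).comp
          (g := fderiv ℝ fun z => fderiv ℝ H z (b i))
          (f := fun y : E => q + t • y) (by fun_prop)).clm_apply
          (continuous_const (y := b i))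
        simp only [Function.comp_def] at this
        fun_prop
    · intro i _
      refine Continuous.integrable_of_hasCompactSupport ?_ (hsupp _)
      have := (hvt i).continuous
      fun_prop
  have hderiv : ∀ t : ℝ, HasDerivAt (fun t : ℝ => ∫ y, radialBump δ y * H (q + t • y))
      (∫ y, radialBump δ y * fderiv ℝ H (q + t • y) y) t := by
    intro t
    have hcont : Continuous fun x : ℝ × E => fderiv ℝ H (q + x.1 • x.2) x.2 :=
      (hH1.comp (by fun_prop)).clm_apply continuous_snd
    obtain ⟨C, hC⟩ := ((isCompact_closedBall t 1).prod (isCompact_closedBall (0 : E) δ)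
      ).exists_bound_of_continuousOn hcont.continuousOn
    refine (hasDerivAt_integral_of_dominated_loc_of_deriv_le (s := Metric.closedBall t 1)
      (F := fun t y => radialBump δ y * H (q + t • y))
      (F' := fun t y => radialBump δ y * fderiv ℝ H (q + t • y) y)
      (bound := fun y => radialBump δ y * C)
      (Metric.closedBall_mem_nhds t one_pos) ?_ ?_ ?_ ?_ ?_ ?_).2
    · exact Eventually.of_forall fun t => (by fun_prop : Continuous _).aestronglyMeasurable
    · exact Continuous.integrable_of_hasCompactSupport (by fun_prop) (hsupp _)
    · have := hcont.comp (f := fun y : E => (t, y)) (by fun_prop)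
      simp only [Function.comp_def] at this
      exact (hc.mul this).aestronglyMeasurable
    · refine Eventually.of_forall fun y s hs' => ?_
      rw [norm_mul, Real.norm_of_nonneg (radialBump_nonneg δ y)]
      rcases le_total δ ‖y‖ with h | h
      · simp [radialBump_eq_zero hδ h]
      · exact mul_le_mul_of_nonneg_left (hC (s, y) ⟨hs', by simpa using h⟩) (radialBump_nonneg δ y)
    · exact (hc.integrable_of_hasCompactSupport hs).mul_const C
    · refine Eventually.of_forall fun y s _ => ?_
      have h1 : HasDerivAt (fun t : ℝ => q + t • y) y s := by
        simpa using ((hasDerivAt_id s).smul_const y).const_add q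
      exact ((hHd _).hasFDerivAt.comp_hasDerivAt s h1).const_mul _
  have hconst := is_const_of_deriv_eq_zero (fun t => (hderiv t).differentiableAt)
    (fun t => by rw [(hderiv t).deriv, hzero t]) 1 0
  simp only [one_smul, zero_smul, add_zero] at hconst
  rw [hconst, integral_mul_const, mul_comm]

end MeanValue

/-! ### Legendre polynomials and zonal solid harmonics -/

open Polynomial in
lemma legendre_eval_one (n : ℕ) : (Planet.legendre n).eval 1 = 1 := by
  have h : ((X ^ 2 - 1 : ℝ[X]) ^ n) = (X - C 1) ^ n * (X + C 1) ^ n := by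
    rw [← mul_pow]
    congr 1
    simp only [map_one]
    ring
  have h2 : (derivative^[n] ((X ^ 2 - 1 : ℝ[X]) ^ n)).eval 1 = n.factorial * 2 ^ n := by
    rw [h, iterate_derivative_mul, eval_finsetSum, Finset.sum_eq_single 0]
    · rw [Nat.sub_zero, iterate_derivative_X_sub_pow_self]
      simp
      norm_num
    · intro k hk hk0
      rw [iterate_derivative_X_sub_pow]
      have : n - (n - k) ≠ 0 := by
        have := Finset.mem_range.1 hk
        omega
      simp [this]
    · simp
  rw [Planet.legendre, eval_mul, h2, eval_C]
  field_simp

/-- The coefficient of `t ^ (n - 2k)` in the Legendre polynomial `P_n`. It vanishes for `2k > n`,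
because of the descending factorial. -/
noncomputable def legendreCoeff (n k : ℕ) : ℝ :=
  (-1) ^ k * n.choose k * ((2 * (n - k)).descFactorial n : ℝ) / (2 ^ n * n.factorial)

lemma legendreCoeff_eq_zero {n k : ℕ} (h : n < 2 * k) : legendreCoeff n k = 0 := by
  by_cases hk : n < k
  · simp [legendreCoeff, Nat.choose_eq_zero_of_lt hk]
  · have : (2 * (n - k)).descFactorial n = 0 := Nat.descFactorial_eq_zero_iff_lt.2 (by omega)
    simp [legendreCoeff, this]

open Polynomial in
lemma legendre_eval (n : ℕ) (t : ℝ) : (Planet.legendre n).eval t =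
    ∑ k ∈ Finset.range (n + 1), legendreCoeff n k * t ^ (n - 2 * k) := by
  have h : ((X ^ 2 - 1 : ℝ[X]) ^ n) =
      ∑ k ∈ Finset.range (n + 1), C ((-1) ^ k * (n.choose k : ℝ)) * X ^ (2 * (n - k)) := by
    rw [sub_eq_neg_add, add_pow]
    refine Finset.sum_congr rfl fun k _ => ?_
    simp only [map_mul, map_pow, map_neg, map_one, map_natCast, pow_mul]
    ring
  rw [Planet.legendre, h, iterate_derivative_sum, eval_mul, eval_finsetSum, eval_C, Finset.mul_sum]
  refine Finset.sum_congr rfl fun k _ => ?_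
  rw [iterate_derivative_C_mul, iterate_derivative_X_pow_eq_C_mul]
  have : 2 * (n - k) - n = n - 2 * k := by omega
  simp only [eval_mul, eval_C, eval_pow, eval_X, this, legendreCoeff]
  ring

lemma legendre_eval_neg_one (n : ℕ) : (Planet.legendre n).eval (-1) = (-1) ^ n := by
  suffices h : (Planet.legendre n).eval (-1) = (-1) ^ n * (Planet.legendre n).eval 1 by
    rw [h, legendre_eval_one, mul_one]
  rw [legendre_eval, legendre_eval, Finset.mul_sum]
  refine Finset.sum_congr rfl fun k _ => ?_
  rcases le_or_gt (2 * k) n with h | h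
  · obtain ⟨j, rfl⟩ := Nat.exists_eq_add_of_le h
    simp only [Nat.add_sub_cancel_left, pow_add, pow_mul, neg_one_sq, one_pow]
    ring
  · simp [legendreCoeff_eq_zero h]

/-- The two-term recursion for the Legendre coefficients; equivalent to the harmonicity of the
solid zonal harmonics. -/
lemma legendreCoeff_succ (n k : ℕ) :
    legendreCoeff n k * ((n - 2 * k : ℕ) * ((n - 2 * k : ℕ) - 1)) +
      legendreCoeff n (k + 1) *
        (2 * (k + 1) * (2 * (k + 1) + 1 + 2 * (n - 2 * (k + 1) : ℕ))) = 0 := by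
  rcases le_or_gt (2 * (k + 1)) n with h | h
  · obtain ⟨j, rfl⟩ := Nat.exists_eq_add_of_le h
    have e1 : 2 * (k + 1) + j - 2 * k = j + 2 := by omega
    have e2 : 2 * (k + 1) + j - 2 * (k + 1) = j := by omega
    have e3 : 2 * (2 * (k + 1) + j - k) = (2 * k + 2 + j) + (j + 2) := by omega
    have e4 : 2 * (2 * (k + 1) + j - (k + 1)) = (2 * k + 2 + j) + j := by omega
    have e0 : 2 * (k + 1) + j = 2 * k + 2 + j := by omega
    have hd1 := Nat.factorial_mul_descFactorial
      (show 2 * k + 2 + j ≤ (2 * k + 2 + j) + (j + 2) by omega)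
    have hd2 := Nat.factorial_mul_descFactorial
      (show 2 * k + 2 + j ≤ (2 * k + 2 + j) + j by omega)
    have hch := Nat.choose_succ_right_eq (2 * k + 2 + j) k
    rw [Nat.add_sub_cancel_left] at hd1 hd2
    rw [show 2 * k + 2 + j - k = k + 2 + j by omega] at hch
    have hf1 : ((2 * k + 2 + j) + (j + 2)).factorial =
        (2 * k + 2 + j + j + 2) * ((2 * k + 2 + j + j + 1) * (2 * k + 2 + j + j).factorial) := rfl
    have hf2 : (j + 2).factorial = (j + 2) * ((j + 1) * j.factorial) := rfl
    rw [hf1, hf2, ← hd2] at hd1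
    simp only [legendreCoeff, e1, e2, e3, e4]
    rw [e0]
    generalize Nat.descFactorial _ (2 * k + 2 + j) = A at *
    generalize Nat.descFactorial _ (2 * k + 2 + j) = B at *
    generalize Nat.choose _ k = c at *
    generalize Nat.choose _ (k + 1) = d at *
    have hj : (0 : ℝ) < j.factorial := by positivity
    have hA : (A : ℝ) * ((j + 2) * (j + 1)) =
        (2 * k + 2 + j + j + 2) * (2 * k + 2 + j + j + 1) * B := by
      have := congrArg (Nat.cast : ℕ → ℝ) hd1
      push_cast at this
      refine mul_left_cancel₀ hj.ne' ?_
      linarith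
    have hc : (d : ℝ) * (k + 1) = c * (k + 2 + j) := by exact_mod_cast hch
    rw [div_mul_eq_mul_div, div_mul_eq_mul_div, ← add_div, div_eq_zero_iff]
    left
    push_cast
    linear_combination ((-1) ^ k * c : ℝ) * hA -
      ((-1) ^ k * B * 2 * (2 * (k + 1) + 1 + 2 * j) : ℝ) * hc
  · rw [legendreCoeff_eq_zero h, zero_mul, add_zero]
    rcases lt_or_ge n (2 * k) with h' | h'
    · rw [legendreCoeff_eq_zero h', zero_mul]
    · have : n - 2 * k = 0 ∨ n - 2 * k = 1 := by omega
      rcases this with h0 | h0 <;> simp [h0]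

/-- The zonal solid harmonic `|y|^n P_n(y₂ / |y|)`, written as a polynomial in `y₂` and `|y|²`. -/
noncomputable def zonalSolid (n : ℕ) (y : Planet.E3) : ℝ :=
  ∑ k ∈ Finset.range (n + 1), legendreCoeff n k * (y 2 ^ (n - 2 * k) * (‖y‖ ^ 2) ^ k)

lemma zonalSolid_eq (n : ℕ) {y : Planet.E3} (hy : y ≠ 0) :
    ‖y‖ ^ n * (Planet.legendre n).eval (Planet.direction y 2) = zonalSolid n y := by
  have hr : ‖y‖ ≠ 0 := norm_ne_zero_iff.2 hy
  rw [legendre_eval, zonalSolid, Finset.mul_sum]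
  refine Finset.sum_congr rfl fun k _ => ?_
  rcases le_or_gt (2 * k) n with h | h
  · obtain ⟨j, rfl⟩ := Nat.exists_eq_add_of_le h
    simp only [Planet.direction, PiLp.smul_apply, smul_eq_mul, Nat.add_sub_cancel_left, mul_pow,
      inv_pow, pow_add, pow_mul]
    field_simp
  · simp [legendreCoeff_eq_zero h]

lemma contDiff_zonalSolid (n : ℕ) : ContDiff ℝ 2 (zonalSolid n) := by
  unfold zonalSolid
  refine ContDiff.sum fun k _ => ?_
  refine contDiff_const.mul (ContDiff.mul (ContDiff.pow ?_ _) ((contDiff_norm_sq ℝ).pow _))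
  exact (EuclideanSpace.proj (𝕜 := ℝ) (2 : Fin 3)).contDiff

lemma fderiv_zonal_monomial (a k : ℕ) (i : Fin 3) (y : Planet.E3) :
    fderiv ℝ (fun y : Planet.E3 => y 2 ^ a * (‖y‖ ^ 2) ^ k) y
      (EuclideanSpace.basisFun (Fin 3) ℝ i) =
    (if i = 2 then a * (y 2 ^ (a - 1) * (‖y‖ ^ 2) ^ k) else 0) +
      2 * k * (y 2 ^ a * (‖y‖ ^ 2) ^ (k - 1)) * y i := by
  have h2 : HasFDerivAt (fun y : Planet.E3 => y 2)
      (EuclideanSpace.proj (𝕜 := ℝ) (2 : Fin 3)) y :=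
    (EuclideanSpace.proj (𝕜 := ℝ) (2 : Fin 3)).hasFDerivAt
  have hq : HasFDerivAt (fun y : Planet.E3 => ‖y‖ ^ 2) (2 • innerSL ℝ y) y :=
    (hasStrictFDerivAt_norm_sq y).hasFDerivAt
  refine (congrArg (fun L => L (EuclideanSpace.basisFun (Fin 3) ℝ i))
    ((h2.pow a).mul (hq.pow k)).fderiv).trans ?_
  fin_cases i <;> simp [EuclideanSpace.inner_single_right] <;> ring

lemma differentiable_zonal_monomial (a k : ℕ) :
    Differentiable ℝ fun y : Planet.E3 => y 2 ^ a * (‖y‖ ^ 2) ^ k := by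
  have h2 : Differentiable ℝ fun y : Planet.E3 => y 2 :=
    (EuclideanSpace.proj (𝕜 := ℝ) (2 : Fin 3)).differentiable
  exact (h2.pow a).mul (((contDiff_norm_sq ℝ).differentiable one_ne_zero).pow k)

lemma sum_fderiv_fderiv_zonal_monomial (a k : ℕ) (y : Planet.E3) :
    ∑ i, fderiv ℝ (fun z => fderiv ℝ (fun y : Planet.E3 => y 2 ^ a * (‖y‖ ^ 2) ^ k) z
      (EuclideanSpace.basisFun (Fin 3) ℝ i)) y (EuclideanSpace.basisFun (Fin 3) ℝ i) =
    a * (a - 1) * (y 2 ^ (a - 2) * (‖y‖ ^ 2) ^ k) +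
      2 * k * (2 * k + 1 + 2 * a) * (y 2 ^ a * (‖y‖ ^ 2) ^ (k - 1)) := by
  have hM := differentiable_zonal_monomial
  have hp : ∀ i : Fin 3, HasFDerivAt (fun y : Planet.E3 => y i)
      (EuclideanSpace.proj (𝕜 := ℝ) i) y := fun i =>
    (EuclideanSpace.proj (𝕜 := ℝ) i).hasFDerivAt
  have key : ∀ i : Fin 3, fderiv ℝ (fun z => fderiv ℝ
      (fun y : Planet.E3 => y 2 ^ a * (‖y‖ ^ 2) ^ k) z
        (EuclideanSpace.basisFun (Fin 3) ℝ i)) y (EuclideanSpace.basisFun (Fin 3) ℝ i) =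
      (if i = 2 then (a : ℝ) else 0) * ((if i = 2 then ((a - 1 : ℕ) : ℝ) *
          (y 2 ^ (a - 1 - 1) * (‖y‖ ^ 2) ^ k) else 0) +
        2 * k * (y 2 ^ (a - 1) * (‖y‖ ^ 2) ^ (k - 1)) * y i) +
      2 * k * (((if i = 2 then a * (y 2 ^ (a - 1) * (‖y‖ ^ 2) ^ (k - 1)) else 0) +
        2 * (k - 1 : ℕ) * (y 2 ^ a * (‖y‖ ^ 2) ^ (k - 1 - 1)) * y i) * y i +
        y 2 ^ a * (‖y‖ ^ 2) ^ (k - 1)) := by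
    intro i
    have e : (fun z => fderiv ℝ (fun y : Planet.E3 => y 2 ^ a * (‖y‖ ^ 2) ^ k) z
        (EuclideanSpace.basisFun (Fin 3) ℝ i)) = fun z =>
        (if i = 2 then (a : ℝ) else 0) * (z 2 ^ (a - 1) * (‖z‖ ^ 2) ^ k) +
        2 * k * ((z 2 ^ a * (‖z‖ ^ 2) ^ (k - 1)) * z i) := by
      funext z
      rw [fderiv_zonal_monomial]
      split_ifs <;> ring
    have h := ((hM (a - 1) k y).hasFDerivAt.const_mul (if i = 2 then (a : ℝ) else 0)).add
      (((hM a (k - 1) y).hasFDerivAt.mul (hp i)).const_mul (2 * k : ℝ))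
    have h' := h.fderiv
    rw [e]
    refine (congrArg (fun L => L (EuclideanSpace.basisFun (Fin 3) ℝ i)) h').trans ?_
    simp only [add_apply, FunLike.coe_smul, Pi.smul_apply, smul_eq_mul,
      fderiv_zonal_monomial]
    simp only [PiLp.proj_apply, EuclideanSpace.basisFun_apply, PiLp.single_apply, if_true]
    ring
  simp_rw [key, Fin.sum_univ_three]
  have hn : ‖y‖ ^ 2 = y 0 ^ 2 + y 1 ^ 2 + y 2 ^ 2 := by
    rw [EuclideanSpace.real_norm_sq_eq, Fin.sum_univ_three]
  simp only [Fin.reduceEq, if_false, if_true, hn]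
  rcases a with _ | _ | a <;> rcases k with _ | _ | k <;> simp <;> ring

/-- The zonal solid harmonics have vanishing Laplacian. -/
lemma sum_fderiv_fderiv_zonalSolid (n : ℕ) (y : Planet.E3) :
    ∑ i, fderiv ℝ (fun z => fderiv ℝ (zonalSolid n) z
      (EuclideanSpace.basisFun (Fin 3) ℝ i)) y (EuclideanSpace.basisFun (Fin 3) ℝ i) = 0 := by
  have hd1 : ∀ i z, fderiv ℝ (zonalSolid n) z (EuclideanSpace.basisFun (Fin 3) ℝ i) =
      ∑ k ∈ Finset.range (n + 1), legendreCoeff n k *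
        fderiv ℝ (fun y : Planet.E3 => y 2 ^ (n - 2 * k) * (‖y‖ ^ 2) ^ k) z
          (EuclideanSpace.basisFun (Fin 3) ℝ i) := by
    intro i z
    have := HasFDerivAt.fun_sum (u := Finset.range (n + 1)) fun k _ =>
      ((differentiable_zonal_monomial (n - 2 * k) k z).hasFDerivAt.const_mul (legendreCoeff n k))
    refine (congrArg (fun L => L (EuclideanSpace.basisFun (Fin 3) ℝ i)) this.fderiv).trans ?_
    simp [sum_apply]
  have hdd : ∀ a k i, Differentiable ℝ fun z =>
      fderiv ℝ (fun y : Planet.E3 => y 2 ^ a * (‖y‖ ^ 2) ^ k) z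
        (EuclideanSpace.basisFun (Fin 3) ℝ i) := by
    intro a k i
    have hp : Differentiable ℝ fun y : Planet.E3 => y i :=
      (EuclideanSpace.proj (𝕜 := ℝ) i).differentiable
    simp_rw [fderiv_zonal_monomial]
    split_ifs
    · exact ((differentiable_zonal_monomial _ _).const_mul _).add
        (((differentiable_zonal_monomial _ _).const_mul _).mul hp)
    · exact (differentiable_const _).add
        (((differentiable_zonal_monomial _ _).const_mul _).mul hp)
  have hd2 : ∀ i, fderiv ℝ (fun z => fderiv ℝ (zonalSolid n) z
      (EuclideanSpace.basisFun (Fin 3) ℝ i)) y (EuclideanSpace.basisFun (Fin 3) ℝ i) =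
      ∑ k ∈ Finset.range (n + 1), legendreCoeff n k *
        fderiv ℝ (fun z => fderiv ℝ (fun y : Planet.E3 => y 2 ^ (n - 2 * k) * (‖y‖ ^ 2) ^ k) z
          (EuclideanSpace.basisFun (Fin 3) ℝ i)) y (EuclideanSpace.basisFun (Fin 3) ℝ i) := by
    intro i
    have := HasFDerivAt.fun_sum (u := Finset.range (n + 1)) fun k _ =>
      ((hdd (n - 2 * k) k i y).hasFDerivAt.const_mul (legendreCoeff n k))
    rw [funext (hd1 i)]
    refine (congrArg (fun L => L (EuclideanSpace.basisFun (Fin 3) ℝ i)) this.fderiv).trans ?_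
    simp [sum_apply]
  simp_rw [hd2]
  rw [Finset.sum_comm]
  simp_rw [← Finset.mul_sum, sum_fderiv_fderiv_zonal_monomial, mul_add]
  -- The two sums telescope against each other after a shift of the second one.
  rw [Finset.sum_add_distrib, Finset.sum_range_succ, Finset.sum_range_succ' (n := n)]
  have hlast : legendreCoeff n n * (((n - 2 * n : ℕ) : ℝ) * (((n - 2 * n : ℕ) : ℝ) - 1) *
      (y 2 ^ (n - 2 * n - 2) * (‖y‖ ^ 2) ^ n)) = 0 := by
    simp [show n - 2 * n = 0 by omega]
  rw [hlast]
  simp only [Nat.cast_zero, mul_zero, zero_mul, add_zero, ← Finset.sum_add_distrib]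
  refine Finset.sum_eq_zero fun k _ => ?_
  have h := legendreCoeff_succ n k
  rw [show n - 2 * k - 2 = n - 2 * (k + 1) by omega, Nat.add_sub_cancel]
  push_cast
  linear_combination (y 2 ^ (n - 2 * (k + 1)) * (‖y‖ ^ 2) ^ k) * h

/-! ### The expansion on the polar axis -/

/-- The north pole of the unit sphere. -/
noncomputable def northPole : Planet.E3 := EuclideanSpace.single 2 1

@[simp] lemma norm_northPole : ‖northPole‖ = 1 := by simp [northPole]

@[simp] lemma northPole_zero : northPole 0 = 0 := by simp [northPole]

@[simp] lemma northPole_one : northPole 1 = 0 := by simp [northPole]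

@[simp] lemma northPole_two : northPole 2 = 1 := by simp [northPole]

lemma direction_smul_northPole {r : ℝ} (hr : 0 < r) :
    Planet.direction (r • northPole) = northPole := by
  rw [Planet.direction, norm_smul, norm_northPole, mul_one, Real.norm_of_nonneg hr.le, smul_smul,
    inv_mul_cancel₀ hr.ne', one_smul]

lemma zonalSolid_south {s : ℝ} (hs : 0 < s) (n : ℕ) :
    zonalSolid n (-(s • northPole)) = (-s) ^ n := by
  have hnorm : ‖-(s • northPole)‖ = s := by
    rw [norm_neg, norm_smul, norm_northPole, mul_one, Real.norm_of_nonneg hs.le]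
  have h0 : -(s • northPole) ≠ 0 := norm_ne_zero_iff.1 (by rw [hnorm]; exact hs.ne')
  have hd : Planet.direction (-(s • northPole)) 2 = -1 := by
    simp [Planet.direction, hnorm, hs.ne']
  rw [← zonalSolid_eq n h0, hnorm, hd, legendre_eval_neg_one, ← mul_pow]
  ring

lemma sphHarm_northPole_of_ne_zero (n : ℕ) {m : ℤ} (hm : m ≠ 0) :
    Planet.sphHarm n m northPole = 0 := by
  have : m.natAbs ≠ 0 := Int.natAbs_ne_zero.2 hm
  simp [Planet.sphHarm, this]

lemma sphHarm_zero (n : ℕ) (u : Planet.E3) :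
    Planet.sphHarm n 0 u = √(2 * n + 1) * (Planet.legendre n).eval (u 2) := by
  have : (n.factorial : ℝ) ≠ 0 := by positivity
  simp [Planet.sphHarm, Planet.normConst, this]

/-- On the axis only the zonal terms survive, and the expansion of the potential is the series of
the moments of the density against the zonal solid harmonics. -/
lemma sheTruncation_axis (G : ℝ) (f : Planet.Density) (hM : 0 < Planet.totalMass f)
    (hR : 0 < Planet.brillouinRadius f) {r : ℝ} (hr : 0 < r) (N : ℕ) :
    Planet.sheTruncation G f N (r • northPole) =
      ∑ n ∈ Finset.range (N + 1), G / r ^ (n + 1) * ∫ y, f y * zonalSolid n y := by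
  rw [Planet.sheTruncation, Finset.mul_sum]
  refine Finset.sum_congr rfl fun n _ => ?_
  rw [direction_smul_northPole hr, Finset.sum_eq_single 0]
  · have hint : ∫ y, f y * (‖y‖ / Planet.brillouinRadius f) ^ n *
        Planet.sphHarm n 0 (Planet.direction y) =
        √(2 * n + 1) / Planet.brillouinRadius f ^ n * ∫ y, f y * zonalSolid n y := by
      rw [← integral_const_mul]
      refine integral_congr_ae ?_
      have h0 : ∀ᵐ y : Planet.E3, y ≠ 0 := by
        rw [ae_iff]
        simp
      filter_upwards [h0] with y hy
      rw [sphHarm_zero, ← zonalSolid_eq n hy, div_pow]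
      ring
    have hsq : √(2 * (n : ℝ) + 1) ^ 2 = 2 * n + 1 := Real.sq_sqrt (by positivity)
    have hn : (0 : ℝ) < 2 * n + 1 := by positivity
    rw [Planet.sheCoeff, hint, sphHarm_zero, northPole_two, legendre_eval_one, norm_smul,
      norm_northPole, mul_one, Real.norm_of_nonneg hr.le]
    generalize ∫ y, f y * zonalSolid n y = I
    rw [div_pow]
    field_simp
    rw [hsq]
    ring
  · intro m _ hm
    rw [sphHarm_northPole_of_ne_zero n hm, mul_zero]
  · intro h
    exact absurd (Finset.mem_Icc.2 ⟨by simp, by simp⟩) h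

/-! ### Densities supported on a ball -/

/-- An affine homeomorphism with the unit sphere transports the stereographic charts. -/
lemma isClosedSurface_sphere (c : Planet.E3) {ρ : ℝ} (hρ : 0 < ρ) :
    Planet.IsClosedSurface (Metric.sphere c ρ) where
  isCompact := isCompact_sphere c ρ
  isConnected := isConnected_sphere (by simp [← Module.finrank_eq_rank]) c hρ.le
  isManifold := by
    have : Fact (Module.finrank ℝ Planet.E3 = 2 + 1) := ⟨by simp⟩
    let e : Planet.E3 ≃ₜ Planet.E3 :=
      (Homeomorph.smulOfNeZero ρ hρ.ne').trans (Homeomorph.addLeft c)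
    let e' : Metric.sphere (0 : Planet.E3) 1 ≃ₜ Metric.sphere c ρ :=
      e.subtype fun x => by
        simp [e, norm_smul, abs_of_pos hρ, hρ.ne']
    have : Nonempty (Metric.sphere c ρ) :=
      (NormedSpace.sphere_nonempty.2 hρ.le).to_subtype
    let := e'.symm.isOpenEmbedding.singletonChartedSpace
    exact ⟨ChartedSpace.comp (EuclideanSpace ℝ (Fin 2)) (Metric.sphere (0 : Planet.E3) 1)
      (Metric.sphere c ρ)⟩

/-- A continuous function that is positive exactly on an open ball containing the origin, as an
admissible density. -/
noncomputable def ballDensity (u : Planet.E3 → ℝ) (hu : Continuous u) (hu0 : ∀ y, 0 ≤ u y)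
    (c : Planet.E3) (ρ : ℝ) (hsupp : Function.support u = Metric.ball c ρ)
    (h0 : (0 : Planet.E3) ∈ Metric.ball c ρ) : Planet.Density :=
  have hρ : 0 < ρ := Metric.pos_of_mem_ball h0
  have hts : tsupport u = Metric.closedBall c ρ := by
    rw [tsupport, hsupp, closure_ball c hρ.ne']
  { toFun := u
    continuous' := hu
    nonneg' := hu0
    hasCompactSupport' := by
      rw [HasCompactSupport, hts]
      exact isCompact_closedBall c ρ
    isConnected_support' := by
      rw [hts]
      exact (convex_closedBall c ρ).isConnected ⟨c, Metric.mem_closedBall_self hρ.le⟩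
    boundary' := by
      refine ⟨1, fun _ => Metric.sphere c ρ, fun _ => isClosedSurface_sphere c hρ,
        fun i j h => absurd (Subsingleton.elim i j) h, ?_⟩
      rw [hts, frontier_closedBall c hρ.ne', Set.iUnion_const]
    zero_mem_interior' := by
      rw [hts, interior_closedBall c hρ.ne']
      exact h0 }

lemma body_ballDensity (u : Planet.E3 → ℝ) (hu : Continuous u) (hu0 : ∀ y, 0 ≤ u y)
    (c : Planet.E3) (ρ : ℝ) (hsupp : Function.support u = Metric.ball c ρ)
    (h0 : (0 : Planet.E3) ∈ Metric.ball c ρ) :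
    Planet.body (ballDensity u hu hu0 c ρ hsupp h0) = Metric.closedBall c ρ := by
  have hρ : 0 < ρ := Metric.pos_of_mem_ball h0
  rw [← closure_ball c hρ.ne', ← hsupp]
  rfl

lemma totalMass_pos (f : Planet.Density) : 0 < Planet.totalMass f := by
  obtain ⟨x, hx⟩ : ∃ x, f x ≠ 0 := by
    by_contra! h
    have := f.isConnected_support'.nonempty
    rw [tsupport_eq_empty_iff.2 (funext h)] at this
    exact Set.not_nonempty_empty this
  exact f.continuous'.integral_pos_of_hasCompactSupport_nonneg_nonzero f.hasCompactSupport'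
    f.nonneg' hx

/-- The Brillouin radius of a ball centred on the negative half-axis. -/
lemma brillouinRadius_of_body_eq_closedBall {f : Planet.Density} {d ρ : ℝ} (hd : 0 ≤ d)
    (hρ : 0 ≤ ρ) (hf : Planet.body f = Metric.closedBall (-(d • northPole)) ρ) :
    Planet.brillouinRadius f = d + ρ := by
  have : {m : ℝ | Planet.body f ⊆ Metric.ball 0 m} = Set.Ioi (d + ρ) := by
    ext m
    rw [Set.mem_ofPred_eq, hf, Set.mem_Ioi]
    constructor
    · intro h
      have hmem : -((d + ρ) • northPole) ∈ Metric.closedBall (-(d • northPole)) ρ := by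
        rw [mem_closedBall_iff_norm, show -((d + ρ) • northPole) - -(d • northPole) =
          -(ρ • northPole) by module, norm_neg, norm_smul, norm_northPole, mul_one,
          Real.norm_of_nonneg hρ]
      have := h hmem
      rwa [mem_ball_zero_iff, norm_neg, norm_smul, norm_northPole, mul_one,
        Real.norm_of_nonneg (by positivity)] at this
    · intro h y hy
      rw [mem_closedBall_iff_norm] at hy
      rw [mem_ball_zero_iff]
      have h1 : ‖y‖ ≤ ‖y - -(d • northPole)‖ + ‖-(d • northPole)‖ := by
        simpa using norm_add_le (y - -(d • northPole)) (-(d • northPole))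
      rw [norm_neg, norm_smul, norm_northPole, mul_one, Real.norm_of_nonneg hd] at h1
      linarith
  rw [Planet.brillouinRadius, this, csInf_Ioi]

/-- A point of the positive half-axis above a ball can escape to infinity along the axis. -/
lemma smul_northPole_mem_outerRegion {d ρ r : ℝ} (hr : 0 < r) (hd : 0 ≤ d) (h : ρ < r + d) :
    r • northPole ∈ Planet.outerRegion (Metric.closedBall (-(d • northPole)) ρ) := by
  have hray : ∀ t ∈ Set.Ici r, t • northPole ∈ (Metric.closedBall (-(d • northPole)) ρ)ᶜ := by
    intro t ht
    have ht' : r ≤ t := ht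
    rw [Set.mem_compl_iff, mem_closedBall_iff_norm, sub_neg_eq_add, ← add_smul, norm_smul,
      norm_northPole, mul_one, Real.norm_of_nonneg (by linarith), not_le]
    linarith
  refine ⟨hray r Set.self_mem_Ici, fun hb => ?_⟩
  have hconn : IsPreconnected ((fun t : ℝ => t • northPole) '' Set.Ici r) :=
    isPreconnected_Ici.image _ (by fun_prop)
  have hsub := hconn.subset_connectedComponentIn (Set.mem_image_of_mem _ Set.self_mem_Ici)
    (Set.forall_mem_image.2 hray)
  obtain ⟨C, hC⟩ := (hb.subset hsub).exists_norm_le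
  have := hC _ (Set.mem_image_of_mem _
    (show max r (C + 1) ∈ Set.Ici r from Set.mem_Ici.2 (le_max_left _ _)))
  rw [norm_smul, norm_northPole, mul_one] at this
  have h2 := le_abs_self (max r (C + 1))
  have h3 := le_max_right r (C + 1)
  rw [Real.norm_eq_abs] at this
  linarith

/-! ### Divergence and density -/

/-- Two densities on the same ball that differ by a bump centred on the axis, farther from the
origin than some free point of the axis, cannot both have a descending expansion: the expansion
of the bump itself diverges at that point. -/
lemma not_epsDescends_and {G ε : ℝ} (hG : 0 < G) {f₁ f₂ : Planet.Density} {d ρ r s δ η : ℝ}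
    (hd : 0 ≤ d) (hρ : 0 < ρ) (hr : 0 < r) (hrs : r < s) (hδ : 0 < δ) (hη : 0 < η)
    (h₁ : Planet.body f₁ = Metric.closedBall (-(d • northPole)) ρ)
    (h₂ : Planet.body f₂ = Metric.closedBall (-(d • northPole)) ρ)
    (hrd : ρ < r + d) (hrR : r < d + ρ) (hε : d + ρ - ε < r)
    (hdiff : ∀ y, f₂ y = f₁ y + η * radialBump δ (y - -(s • northPole))) :
    ¬ (Planet.EpsDescends G ε f₁ ∧ Planet.EpsDescends G ε f₂) := by
  rintro ⟨⟨g₁, hg₁⟩, ⟨g₂, hg₂⟩⟩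
  have hR₁ := brillouinRadius_of_body_eq_closedBall hd hρ.le h₁
  have hR₂ := brillouinRadius_of_body_eq_closedBall hd hρ.le h₂
  have hnorm : ‖r • northPole‖ = r := by
    rw [norm_smul, norm_northPole, mul_one, Real.norm_of_nonneg hr.le]
  have hmem := smul_northPole_mem_outerRegion hr hd hrd
  have ht : ∀ {f : Planet.Density} {g : Planet.E3 → ℝ},
      Planet.body f = Metric.closedBall (-(d • northPole)) ρ →
      Planet.brillouinRadius f = d + ρ →
      TendstoUniformlyOn (fun N x => Planet.sheTruncation G f N x) g atTop
        {x | x ∈ Planet.freeSpace f ∧ Planet.brillouinRadius f - ε < ‖x‖} →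
      Tendsto (fun n => G / r ^ (n + 1 + 1) * ∫ y, f y * zonalSolid (n + 1) y) atTop (𝓝 0) := by
    intro f g hf hR hg
    have hx := hg.tendsto_at (x := r • northPole)
      ⟨⟨by rw [hf]; exact hmem, by rw [mem_ball_zero_iff, hnorm, hR]; exact hrR⟩,
        by rw [hnorm, hR]; exact hε⟩
    have hsub := (hx.comp (tendsto_add_atTop_nat 1)).sub hx
    rw [sub_self] at hsub
    refine hsub.congr fun n => ?_
    simp only [Function.comp_apply]
    rw [sheTruncation_axis G f (totalMass_pos f) (by rw [hR]; positivity) hr,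
      sheTruncation_axis G f (totalMass_pos f) (by rw [hR]; positivity) hr,
      Finset.sum_range_succ _ (n + 1), add_sub_cancel_left]
  have hlim := (ht h₂ hR₂ hg₂).sub (ht h₁ hR₁ hg₁)
  set c : ℝ := ∫ y : Planet.E3, radialBump δ y with hc
  have hc0 : 0 < c :=
    (continuous_radialBump δ).integral_pos_of_hasCompactSupport_nonneg_nonzero
      (hasCompactSupport_radialBump hδ.le) (radialBump_nonneg δ) (radialBump_zero_pos hδ).ne'
  have hs0 : 0 < s := hr.trans hrs
  have hmoment : ∀ n, ∫ y, f₂ y * zonalSolid n y =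
      (∫ y, f₁ y * zonalSolid n y) + η * ((-s) ^ n * c) := by
    intro n
    have hz := (contDiff_zonalSolid n).continuous
    have hb := continuous_radialBump (E := Planet.E3) δ
    have hm : ∫ y, radialBump δ (y - -(s • northPole)) * zonalSolid n y = (-s) ^ n * c := by
      rw [← zonalSolid_south hs0, hc,
        ← integral_radialBump_mul_harmonic (EuclideanSpace.basisFun (Fin 3) ℝ)
          (contDiff_zonalSolid n) (sum_fderiv_fderiv_zonalSolid n) hδ.le,
        ← integral_add_right_eq_self
          (fun y => radialBump δ (y - -(s • northPole)) * zonalSolid n y) (-(s • northPole))]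
      simp only [add_sub_cancel_right, add_comm]
    rw [← hm, ← integral_const_mul, ← integral_add]
    · refine integral_congr_ae (Eventually.of_forall fun y => ?_)
      simp only [hdiff]
      ring
    · exact (f₁.continuous'.mul hz).integrable_of_hasCompactSupport
        (f₁.hasCompactSupport'.mul_right)
    · refine Integrable.const_mul (Continuous.integrable_of_hasCompactSupport (by fun_prop) ?_) _
      exact ((hasCompactSupport_radialBump hδ.le).comp_homeomorph
        (Homeomorph.subRight (-(s • northPole)))).mul_right
  -- The terms of the expansion of the bump stay away from zero.
  have hlow : ∀ n, G * η * c / r ≤ |G / r ^ (n + 1 + 1) * (∫ y, f₂ y * zonalSolid (n + 1) y) -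
      G / r ^ (n + 1 + 1) * ∫ y, f₁ y * zonalSolid (n + 1) y| := by
    intro n
    rw [hmoment, ← mul_sub, add_sub_cancel_left, abs_mul, abs_mul, abs_mul, abs_pow, abs_neg,
      abs_of_pos hs0, abs_of_pos hη, abs_of_pos hc0, abs_of_pos (by positivity)]
    have : r ^ (n + 1) ≤ s ^ (n + 1) := pow_le_pow_left₀ hr.le hrs.le _
    rw [div_mul_eq_mul_div, div_le_div_iff₀ hr (by positivity), pow_succ r (n + 1)]
    have hk : 0 < G * η * c * r := by positivity
    nlinarith [mul_le_mul_of_nonneg_left this hk.le]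
  have hpos : 0 < G * η * c / r := by positivity
  have habs := hlim.abs
  rw [sub_zero, abs_zero] at habs
  exact absurd (ge_of_tendsto' habs hlow) (not_le.2 hpos)

lemma weightedNorm_ne_top (p : ℝ≥0∞) {w : Planet.E3 → ℝ} (hw : Continuous w)
    {g : Planet.E3 → ℝ} (hg : Continuous g) (hgc : HasCompactSupport g) :
    Planet.weightedNorm p w g ≠ ∞ := by
  have := IsLocallyFiniteMeasure.withDensity_ofReal (μ := (volume : Measure Planet.E3)) hw
  exact (hg.memLp_of_hasCompactSupport hgc).eLpNorm_ne_top

/-- Every weighted ball around a density contains one whose expansion does not descend. -/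
lemma exists_not_epsDescends {G : ℝ} (hG : 0 < G) {p : ℝ≥0∞}
    {w : Planet.E3 → ℝ} (hw : Continuous w) {ε : ℝ} (hε : 0 < ε) (f : Planet.Density)
    {κ : ℝ≥0∞} (hκ : κ ≠ 0) :
    ∃ h : Planet.Density, ¬ Planet.EpsDescends G ε h ∧
      Planet.weightedNorm p w (fun y => f y - h y) < κ := by
  obtain ⟨A, hA0, hA⟩ : ∃ A > 0, tsupport f.toFun ⊆ Metric.ball 0 A := by
    obtain ⟨A, hA⟩ := f.hasCompactSupport'.isBounded.subset_ball (0 : Planet.E3)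
    exact ⟨max A 1, by positivity, hA.trans (Metric.ball_subset_ball (le_max_left _ _))⟩
  -- The new planet is the ball of radius `A + d` centred at `-(d • northPole)`. It reaches the
  -- distances `A` to the north and `A + 2 * d` to the south; the bump is at `A + 3 / 2 * d` to the
  -- south, the point of divergence at `A + d` to the north.
  set d : ℝ := ε / 2 with hd
  have hd0 : 0 < d := by positivity
  set c : Planet.E3 := -(d • northPole) with hc
  set q : Planet.E3 := -((A + 3 / 2 * d) • northPole) with hq
  have hcn : ‖c‖ = d := by
    rw [hc, norm_neg, norm_smul, norm_northPole, mul_one, Real.norm_of_nonneg hd0.le]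
  have hqc : ‖q - c‖ = A + d / 2 := by
    rw [show q - c = -((A + d / 2) • northPole) by rw [hq, hc]; module, norm_neg, norm_smul,
      norm_northPole, mul_one, Real.norm_of_nonneg (by positivity)]
  set cone : Planet.E3 → ℝ := fun y => max 0 (A + d - ‖y - c‖) with hcone
  set bump : Planet.E3 → ℝ := fun y => radialBump (d / 2) (y - q) with hbump
  have hcone_cont : Continuous cone := by fun_prop
  have hbump_cont : Continuous bump := by
    have := continuous_radialBump (E := Planet.E3) (d / 2)
    fun_prop
  have hbump0 : ∀ y, 0 ≤ bump y := fun y => radialBump_nonneg _ _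
  have hcone_pos : ∀ y ∈ Metric.ball c (A + d), 0 < cone y := by
    intro y hy
    rw [mem_ball_iff_norm] at hy
    exact lt_max_of_lt_right (by linarith)
  have hcone_out : ∀ y ∉ Metric.ball c (A + d), cone y = 0 := by
    intro y hy
    rw [mem_ball_iff_norm, not_lt] at hy
    exact max_eq_left (by linarith)
  have hbump_out : ∀ y ∉ Metric.ball c (A + d), bump y = 0 := by
    intro y hy
    rw [mem_ball_iff_norm, not_lt] at hy
    refine radialBump_eq_zero (by positivity) ?_
    have : ‖y - c‖ ≤ ‖y - q‖ + ‖q - c‖ := by simpa using norm_add_le (y - q) (q - c)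
    linarith
  have hf_out : ∀ y ∉ Metric.ball c (A + d), f y = 0 := by
    intro y hy
    by_contra hfy
    have h1 : ‖y‖ < A := by simpa using hA (subset_tsupport _ hfy)
    have h2 := norm_sub_le y c
    exact hy (mem_ball_iff_norm.2 (by linarith))
  have hcompact : ∀ u : Planet.E3 → ℝ, (∀ y ∉ Metric.ball c (A + d), u y = 0) →
      HasCompactSupport u := fun u hu =>
    HasCompactSupport.of_support_subset_isCompact (isCompact_closedBall c (A + d)) fun y hy => by
      by_contra h
      exact hy (hu y fun h' => h (Metric.ball_subset_closedBall h'))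
  have h0 : (0 : Planet.E3) ∈ Metric.ball c (A + d) := by
    rw [mem_ball_iff_norm, zero_sub, norm_neg, hcn]
    linarith
  -- Small multiples of `cone` and of `cone + bump` are added to `f`.
  have hW := (max_lt (weightedNorm_ne_top p hw hcone_cont (hcompact _ hcone_out)).lt_top
    (weightedNorm_ne_top p hw (hcone_cont.add hbump_cont)
      (hcompact _ fun y hy => by simp [hcone_out y hy, hbump_out y hy])).lt_top).ne
  obtain ⟨η, hη, hηW⟩ := ENNReal.exists_nnreal_pos_mul_lt hW hκ
  have hη' : (0 : ℝ) < η := hη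
  have hsmall : ∀ g : Planet.E3 → ℝ, Planet.weightedNorm p w g ≤
      max (Planet.weightedNorm p w cone) (Planet.weightedNorm p w (cone + bump)) →
      Planet.weightedNorm p w (fun y => f y - (f y + η * g y)) < κ := by
    intro g hg
    refine lt_of_le_of_lt ?_ hηW
    have e : (fun y => f y - (f y + η * g y)) = (-(η : ℝ)) • g := by
      funext y
      simp
    rw [e, Planet.weightedNorm, eLpNorm_const_smul, enorm_neg]
    have : ‖(η : ℝ)‖ₑ = η := by simp
    rw [this]
    exact mul_le_mul_right hg _
  have hdens : ∀ g : Planet.E3 → ℝ, Continuous g → (∀ y ∈ Metric.ball c (A + d), 0 < g y) →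
      (∀ y ∉ Metric.ball c (A + d), g y = 0) → ∃ h : Planet.Density,
        (∀ y, h y = f y + η * g y) ∧ Planet.body h = Metric.closedBall c (A + d) := by
    intro g hg hpos hout
    have hg0 : ∀ y, 0 ≤ g y := fun y => by
      by_cases hy : y ∈ Metric.ball c (A + d)
      · exact (hpos y hy).le
      · exact (hout y hy).ge
    have hsupp : Function.support (fun y => f y + η * g y) = Metric.ball c (A + d) := by
      ext y
      rw [Function.mem_support]
      constructor
      · intro h
        by_contra hy
        exact h (by rw [hf_out y hy, hout y hy]; simp)
      · intro hy
        exact (add_pos_of_nonneg_of_pos (f.nonneg' y) (mul_pos hη' (hpos y hy))).ne'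
    exact ⟨ballDensity _ (f.continuous'.add (continuous_const.mul hg))
      (fun y => add_nonneg (f.nonneg' y) (mul_nonneg hη'.le (hg0 y))) c (A + d) hsupp h0,
      fun y => rfl, body_ballDensity ..⟩
  obtain ⟨f₁, hf₁, hb₁⟩ := hdens cone hcone_cont hcone_pos hcone_out
  obtain ⟨f₂, hf₂, hb₂⟩ := hdens (cone + bump) (hcone_cont.add hbump_cont)
    (fun y hy => add_pos_of_pos_of_nonneg (hcone_pos y hy) (hbump0 y))
    (fun y hy => by simp [hcone_out y hy, hbump_out y hy])
  have hnot := not_epsDescends_and (G := G) (ε := ε) (r := A + d) (s := A + 3 / 2 * d) (δ := d / 2)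
    hG hd0.le (by positivity) (by positivity) (by linarith) (by positivity) hη' hb₁ hb₂
    (by linarith) (by linarith) (by linarith)
    (fun y => by
      rw [hf₁, hf₂, Pi.add_apply]
      ring)
  by_cases h₁ : Planet.EpsDescends G ε f₁
  · refine ⟨f₂, fun h₂ => hnot ⟨h₁, h₂⟩, ?_⟩
    simp_rw [hf₂]
    exact hsmall _ (le_max_right _ _)
  · refine ⟨f₁, h₁, ?_⟩
    simp_rw [hf₁]
    exact hsmall _ (le_max_left _ _)

theorem corollary1 (G : ℝ) (hG : 0 < G) (p : ℝ≥0∞) (hp : 1 ≤ p)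
    (w : Planet.E3 → ℝ) (hw : Continuous w) (hw0 : ∀ x, 0 < w x) (ε : ℝ) (hε : 0 < ε) :
    @interior Planet.Density (Planet.weightedTopology p hp w) (Planet.descendSet G ε) = ∅ ∧
    @Dense Planet.Density (Planet.weightedTopology p hp w) (Planet.descendSet G ε)ᶜ := by
  let := Planet.weightedMetric p hp w
  have hdense : Dense (Planet.descendSet G ε)ᶜ := by
    intro f
    rw [EMetric.mem_closure_iff]
    intro κ hκ
    obtain ⟨h, hh, hlt⟩ := exists_not_epsDescends (p := p) hG hw hε f hκ.ne'
    exact ⟨h, hh, hlt⟩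
  exact ⟨interior_eq_empty_iff_dense_compl.2 hdense, hdense⟩
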